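/- Let $n\ge 2$ and $k\ge 0$ be integers with $n\ge 4k^2+4k$. Let $S_n$ be the symmetric group on $\{1,\dots,n\}$. For non-negative real numbers $A=(a_{ij})_{1\le i<j\le n}$ let $$\Delta_A=\sum_{i<j}a_{ij}\,\bigl(\mathrm{id}-(i\,j)\bigr)\in\mathbb{R}[S_n],$$ and for a nonzero finite-dimensional (real or complex) representation $\rho$ of $S_n$ let $\lambda_1(A;\rho)$ be the smallest eigenvalue of $\rho(\Delta_A)$ (all eigenvalues of $\rho(\Delta_A)$ are real). The irreducible representation of $S_n$ indexed by a Young diagram with $n$ boxes is (up to isomorphism) the left ideal of the group ring generated by the Young symmetrizer $ab$ of a numbering of the boxes by $1,\dots,n$, where $a$ is the sum of the permutations preserving the rows and $b$ is the signed sum of the permutations preserving the columns. The Aldous order is defined by $$\rho\preceq\rho' \iff \lambda_1(A;\rho)\ge\lambda_1(A;\rho')\ \text{ for all non-negative } A,$$ and $\rho\prec\rho'$ means that $\rho\preceq\rho'$ and $\rho,\rho'$ are not isomorphic. Let $\tau$ be an irreducible representation of $S_n$ whose Young diagram has at least $n-k$ boxes in the first row, and let $\sigma$ be an irreducible representation of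 $S_n$ whose Young diagram has at least $n-k$ boxes in the leftmost column. Then $\tau\succ\sigma$. That is, $\lambda_1(A;\tau)\le\lambda_1(A;\sigma)$ for every choice of non-negative weights $A$, and $\tau$ and $\sigma$ are not isomorphic. -/

import Mathlib

open scoped MonoidAlgebra InnerProductSpace

noncomputable section

namespace AldousOrder

/-- The symmetric group on `n` letters. -/
abbrev Sym (n : ℕ) : Type := Equiv.Perm (Fin n)

section Specht

variable (𝕜 : Type*) [RCLike 𝕜] {n : ℕ} {μ : YoungDiagram}

/-- The row of the letter `x` in the numbering `T` of the boxes of `μ` by the letters. -/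
def rowOf (T : Fin n ≃ μ.cells) (x : Fin n) : ℕ := (T x).1.1

/-- The column of the letter `x` in the numbering `T` of the boxes of `μ` by the letters. -/
def colOf (T : Fin n ≃ μ.cells) (x : Fin n) : ℕ := (T x).1.2

open Classical in
/-- The sum, in the group ring, of all permutations that preserve the rows of `T`. -/
def rowSum (T : Fin n ≃ μ.cells) : 𝕜[Sym n] :=
  ∑ h : Sym n with ∀ x, rowOf T (h x) = rowOf T x, MonoidAlgebra.of 𝕜 (Sym n) h

open Classical in
/-- The signed sum, in the group ring, of all permutations that preserve the columns of `T`. -/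
def colSum (T : Fin n ≃ μ.cells) : 𝕜[Sym n] :=
  ∑ v : Sym n with ∀ x, colOf T (v x) = colOf T x,
    ((Equiv.Perm.sign v : ℤ) : 𝕜) • MonoidAlgebra.of 𝕜 (Sym n) v

/-- The Young symmetrizer of `T`. -/
def youngSymmetrizer (T : Fin n ≃ μ.cells) : 𝕜[Sym n] := rowSum 𝕜 T * colSum 𝕜 T

/-- The Specht module of `T`: the left ideal of the group ring generated by the Young symmetrizer,
with the symmetric group acting by multiplication from the left. -/
def specht (T : Fin n ≃ μ.cells) :
    Representation 𝕜 (Sym n) (Ideal.span {youngSymmetrizer 𝕜 T}) :=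
  Representation.ofModule' _

end Specht

section Order

variable {𝕜 : Type*} [RCLike 𝕜] {n : ℕ}
  {V : Type*} [AddCommGroup V] [Module 𝕜 V] {W : Type*} [AddCommGroup W] [Module 𝕜 W]

/-- `ρ` is (isomorphic to) the irreducible representation of the symmetric group indexed by the
Young diagram `μ`. Different numberings of the boxes of `μ` give isomorphic Specht modules; the
existence of a numbering forces `μ` to have exactly `n` boxes. -/
def HasYoungDiagram (ρ : Representation 𝕜 (Sym n) V) (μ : YoungDiagram) : Prop :=
  ∃ T : Fin n ≃ μ.cells, Nonempty (ρ.Equiv (specht 𝕜 T))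

variable (𝕜) in
/-- `Δ_A = ∑_{i<j} a_{ij} (id - (i j))` in the group ring. Only the entries of `A` above the
diagonal are used. -/
def laplacian (A : Matrix (Fin n) (Fin n) ℝ) : 𝕜[Sym n] :=
  ∑ i, ∑ j ∈ Finset.Ioi i,
    (A i j : 𝕜) • (1 - MonoidAlgebra.of 𝕜 (Sym n) (Equiv.swap i j))

/-- The set of real eigenvalues of `ρ(Δ_A)`. (All eigenvalues are real.) -/
def eigenvalueSet (A : Matrix (Fin n) (Fin n) ℝ) (ρ : Representation 𝕜 (Sym n) V) : Set ℝ :=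
  {x | Module.End.HasEigenvalue (ρ.asAlgebraHom (laplacian 𝕜 A)) (x : 𝕜)}

/-- The smallest eigenvalue `λ₁(A; ρ)` of `ρ(Δ_A)`. -/
def lambda1 (A : Matrix (Fin n) (Fin n) ℝ) (ρ : Representation 𝕜 (Sym n) V) : ℝ :=
  sInf (eigenvalueSet A ρ)

/-- On a nonzero finite-dimensional representation, `lambda1` is indeed the least eigenvalue. -/
theorem lambda1_isLeast  [FiniteDimensional 𝕜 V] [Nontrivial V]
   (A : Matrix (Fin n) (Fin n) ℝ) (ρ : Representation 𝕜 (Sym n) V) :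
   IsLeast (eigenvalueSet A ρ) (lambda1 A ρ) := by
  have hfin : (eigenvalueSet A ρ).Finite :=
    (Module.End.finite_hasEigenvalue (ρ.asAlgebraHom (laplacian 𝕜 A))).preimage
      (f := fun x : ℝ => (x : 𝕜)) (RCLike.ofReal_injective.injOn)
  suffices hne : (eigenvalueSet A ρ).Nonempty from
    ⟨hne.csInf_mem hfin, fun x hx => csInf_le hfin.bddBelow hx⟩
  let b := Module.finBasis 𝕜 V
  let e : V ≃ₗ[𝕜] EuclideanSpace 𝕜 (Fin (Module.finrank 𝕜 V)) :=
    b.equivFun ≪≫ₗ (WithLp.linearEquiv 2 𝕜 _).symm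
  let c : InnerProductSpace.Core 𝕜 V :=
    { inner := fun x y => ∑ g : Sym n, ⟪e (ρ g x), e (ρ g y)⟫_𝕜
      conj_inner_symm := fun x y => by simp [map_sum]
      re_inner_nonneg := fun x => by
        simp only [map_sum]
        exact Finset.sum_nonneg fun g _ => inner_self_nonneg
      add_left := fun x y z => by simp [inner_add_left, Finset.sum_add_distrib]
      smul_left := fun x y r => by simp [inner_smul_left, Finset.mul_sum]
      definite := fun x hx => by
        have h2 : ∑ g : Sym n, RCLike.re ⟪e (ρ g x), e (ρ g x)⟫_𝕜 = 0 := by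
          rw [← map_sum]; exact (congrArg RCLike.re hx).trans (map_zero _)
        rw [Finset.sum_eq_zero_iff_of_nonneg (fun g _ => inner_self_nonneg)] at h2
        have h3 := h2 1 (Finset.mem_univ _)
        simpa using h3 }
  let _ : NormedAddCommGroup V := c.toNormedAddCommGroup
  let _ : InnerProductSpace 𝕜 V := InnerProductSpace.ofCore c.toCore
  have hin : ∀ x y : V, ⟪x, y⟫_𝕜 = ∑ g : Sym n, ⟪e (ρ g x), e (ρ g y)⟫_𝕜 := fun x y => rfl
  have hinv : ∀ h : Sym n, ∀ x y : V, ⟪ρ h x, ρ h y⟫_𝕜 = ⟪x, y⟫_𝕜 := by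
    intro h x y
    rw [hin, hin, ← Equiv.sum_comp (Equiv.mulRight h) (fun g => ⟪e (ρ g x), e (ρ g y)⟫_𝕜)]
    simp
  have hs : (ρ.asAlgebraHom (laplacian 𝕜 A)).IsSymmetric := by
    unfold laplacian
    simp only [map_sum, map_smul, map_sub, map_one, Representation.asAlgebraHom_of]
    intro x y
    simp only [LinearMap.sum_apply, LinearMap.smul_apply, LinearMap.sub_apply, sum_inner, inner_sum,
      inner_smul_left, inner_smul_right, RCLike.conj_ofReal, inner_sub_left, inner_sub_right]
    refine Finset.sum_congr rfl fun i _ => Finset.sum_congr rfl fun j _ => ?_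
    congr 2
    rw [← hinv (Equiv.swap i j)]
    congr 1
    rw [← Module.End.mul_apply, ← map_mul]; simp
  have := hs.hasEigenvalue_iInf_of_finiteDimensional
  exact ⟨_, this⟩

/-- `ρ ⪯ σ` in the Aldous order: `λ₁(A; ρ) ≥ λ₁(A; σ)` for all non-negative weights `A`. -/
def AldousLE (ρ : Representation 𝕜 (Sym n) V) (σ : Representation 𝕜 (Sym n) W) : Prop :=
  ∀ A : Matrix (Fin n) (Fin n) ℝ, (∀ i j, i < j → 0 ≤ A i j) → lambda1 A σ ≤ lambda1 A ρ

/-- `ρ ≺ σ` in the Aldous order: `ρ ⪯ σ`, and `ρ`, `σ` are different (not isomorphic). -/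
def AldousLT (ρ : Representation 𝕜 (Sym n) V) (σ : Representation 𝕜 (Sym n) W) : Prop :=
  AldousLE ρ σ ∧ ¬ Nonempty (ρ.Equiv σ)

end Order

end AldousOrder

end

/-! Realise both representations in the group ring, where the quadratic form of the Laplacian is a
weighted sum of swap energies, and compare these energies pair by pair. Write `a` and `b` for the
row and column sums of a numbering, and `N` and `M` for the squared norms of `f` and `w` below.

Let `f` be an eigenvector for `σ` in its left ideal of `ab`. It is antisymmetric on the right under
the long first column `C`, so a pair `i`, `j` contributes about `2N`, less a loss governed by the
masses of `f` at `i` and `j`. These masses total at most `kN` (`sum_mass`, `le_swapEnergy`). For `τ`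
take the test vector `w = ba`. It is symmetric on the right under the long first row, so its swap
energy is at most twice the sum of its two masses (`swapEnergy_le`), and its mass sits on at most
`2k` letters (`card_deepCols_le`, `mem_deepCols_of_coeff_ne_zero`).

Call the `2k(k+1)` letters where `f` has most mass heavy. Average over the translates of `w` whose
mass lies on light letters. The averaged energy vanishes on heavy pairs, is at most `M/(k+1)` on
mixed pairs and at most `M` on light pairs; the energy of `f` is at least `0`, at least `N/(k+1)`
and more than `N` respectively. As `n ≥ 4k²+4k`, there are enough light letters. Every translate of
`w` has Rayleigh quotient at least `λ₁(τ)`, because right multiplication by `b` embeds the left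
ideal of `ba` in that of `ab` (`eq_zero_of_mul_colSum_eq_zero`). Summing over pairs gives `λ₁(τ) ≤
λ₁(σ)`, strictly for positive weights, and strictness excludes an isomorphism. -/

noncomputable section

namespace AldousOrder

/-! ### Swap energies and masses of functions on the symmetric group -/

section Energy

variable {𝕜 : Type*} [RCLike 𝕜] {n : ℕ}

/-- The squared `ℓ²`-norm of a function on the symmetric group. -/
def sqNorm (f : Sym n → 𝕜) : ℝ := ∑ g, ‖f g‖ ^ 2

/-- The part of the squared norm of `f` carried by the permutations sending some letter outside
`C` to `i`. -/
def mass (f : Sym n → 𝕜) (C : Finset (Fin n)) (i : Fin n) : ℝ :=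
  ∑ g : Sym n, if g⁻¹ i ∈ C then 0 else ‖f g‖ ^ 2

/-- The quadratic form of `id - (i j)`, acting on functions by left translation. -/
def swapEnergy (f : Sym n → 𝕜) (i j : Fin n) : ℝ :=
  ∑ g : Sym n, (1 / 2 : ℝ) * ‖f g - f (Equiv.swap i j * g)‖ ^ 2

/-- The left translate of `f` by `π`. -/
def translate (π : Sym n) (f : Sym n → 𝕜) : Sym n → 𝕜 := fun g => f (π⁻¹ * g)

lemma sqNorm_pos {f : Sym n → 𝕜} (hf : f ≠ 0) : 0 < sqNorm f := by
  obtain ⟨g, hg⟩ := Function.ne_iff.1 hf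
  exact Finset.sum_pos' (fun _ _ => by positivity)
    ⟨g, Finset.mem_univ _, by have := norm_pos_iff.2 hg; positivity⟩

lemma mass_nonneg (f : Sym n → 𝕜) (C : Finset (Fin n)) (i : Fin n) : 0 ≤ mass f C i :=
  Finset.sum_nonneg fun g _ => by split_ifs <;> positivity

lemma mass_le_sqNorm (f : Sym n → 𝕜) (C : Finset (Fin n)) (i : Fin n) :
    mass f C i ≤ sqNorm f :=
  Finset.sum_le_sum fun g _ => by split_ifs <;> first | positivity | exact le_rfl

lemma swapEnergy_nonneg (f : Sym n → 𝕜) (i j : Fin n) : 0 ≤ swapEnergy f i j :=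
  Finset.sum_nonneg fun g _ => by positivity

lemma swapEnergy_comm (f : Sym n → 𝕜) (i j : Fin n) : swapEnergy f i j = swapEnergy f j i := by
  simp only [swapEnergy, Equiv.swap_comm i j]

/-- For each `g`, exactly `|Cᶜ|` letters `i` have `g⁻¹ i` outside `C`. -/
lemma sum_mass (f : Sym n → 𝕜) (C : Finset (Fin n)) :
    ∑ i, mass f C i = (Cᶜ.card : ℝ) * sqNorm f := by
  simp only [mass]
  rw [Finset.sum_comm, sqNorm, Finset.mul_sum]
  refine Finset.sum_congr rfl fun g _ => ?_
  rw [Equiv.sum_comp g⁻¹ (fun x => if x ∈ C then (0 : ℝ) else ‖f g‖ ^ 2)]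
  simp only [← ite_not (_ ∈ C)]
  rw [← Finset.sum_filter, Finset.sum_const, nsmul_eq_mul, Finset.filter_not]
  simp [Finset.compl_eq_univ_sdiff]

lemma sqNorm_swap_mul (f : Sym n → 𝕜) (i j : Fin n) :
    ∑ g : Sym n, ‖f (Equiv.swap i j * g)‖ ^ 2 = sqNorm f :=
  Equiv.sum_comp (Equiv.mulLeft (Equiv.swap i j)) fun g => ‖f g‖ ^ 2

/-- The preimage of `i` under `(i j) g` is the preimage of `j` under `g`, so translation exchanges
the two masses. -/
lemma mass_swap_left (f : Sym n → 𝕜) (C : Finset (Fin n)) (i j : Fin n) :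
    ∑ g : Sym n, (if g⁻¹ i ∈ C then 0 else ‖f (Equiv.swap i j * g)‖ ^ 2) = mass f C j := by
  rw [mass, ← Equiv.sum_comp (Equiv.mulLeft (Equiv.swap i j))]
  simp

lemma mass_swap_right (f : Sym n → 𝕜) (C : Finset (Fin n)) (i j : Fin n) :
    ∑ g : Sym n, (if g⁻¹ j ∈ C then 0 else ‖f (Equiv.swap i j * g)‖ ^ 2) = mass f C i := by
  rw [mass, ← Equiv.sum_comp (Equiv.mulLeft (Equiv.swap i j))]
  simp

/-- If both preimages lie in `C`, antisymmetry makes the term of `g` equal to `‖f g‖² + ‖f (swap *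
g)‖²`, which sums to `2N`. If one lies outside, the cross term is absorbed by `2xy ≤ s⁻¹x² + sy²`;
if both do, the bound is nonpositive. The parameter `s` allows unequal weights on the two masses. -/
lemma le_swapEnergy {f : Sym n → 𝕜} {C : Finset (Fin n)} {i j : Fin n} {s : ℝ} (hs : 0 < s)
    (hf : ∀ g : Sym n, g⁻¹ i ∈ C → g⁻¹ j ∈ C → f (Equiv.swap i j * g) = -f g) :
    2 * sqNorm f - (1 + s⁻¹) * mass f C i - (1 + s) * mass f C j ≤ swapEnergy f i j := by
  have e : 2 * sqNorm f - (1 + s⁻¹) * mass f C i - (1 + s) * mass f C j =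
      ∑ g : Sym n, ((‖f g‖ ^ 2 + ‖f (Equiv.swap i j * g)‖ ^ 2)
        - (1 + s⁻¹) / 2 * ((if g⁻¹ i ∈ C then 0 else ‖f g‖ ^ 2) +
            if g⁻¹ j ∈ C then 0 else ‖f (Equiv.swap i j * g)‖ ^ 2)
        - (1 + s) / 2 * ((if g⁻¹ j ∈ C then 0 else ‖f g‖ ^ 2) +
            if g⁻¹ i ∈ C then 0 else ‖f (Equiv.swap i j * g)‖ ^ 2)) := by
    simp only [Finset.sum_sub_distrib, ← Finset.mul_sum, Finset.sum_add_distrib, sqNorm_swap_mul,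
      mass_swap_left, mass_swap_right]
    rw [← mass, ← mass, ← sqNorm]
    ring
  rw [e, swapEnergy]
  refine Finset.sum_le_sum fun g _ => ?_
  have h1 : (‖f g‖ - ‖f (Equiv.swap i j * g)‖) ^ 2 ≤ ‖f g - f (Equiv.swap i j * g)‖ ^ 2 := by
    rw [← sq_abs]
    exact pow_le_pow_left₀ (abs_nonneg _) (abs_norm_sub_norm_le _ _) 2
  have key : ∀ x y : ℝ, 2 * x * y ≤ s⁻¹ * x ^ 2 + s * y ^ 2 := fun x y => by
    have : 0 ≤ s⁻¹ * (x - s * y) ^ 2 := by positivity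
    have e : s⁻¹ * (x - s * y) ^ 2 = s⁻¹ * x ^ 2 + s * y ^ 2 - 2 * x * y := by field_simp; ring
    linarith
  have k1 := key ‖f g‖ ‖f (Equiv.swap i j * g)‖
  have k2 := key ‖f (Equiv.swap i j * g)‖ ‖f g‖
  by_cases hi : g⁻¹ i ∈ C <;> by_cases hj : g⁻¹ j ∈ C <;> simp only [hi, hj, if_true, if_false]
  · have h2 : ‖f g - f (Equiv.swap i j * g)‖ = 2 * ‖f g‖ := by
      rw [hf g hi hj, sub_neg_eq_add, ← two_mul, norm_mul, RCLike.norm_two]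
    have h3 : ‖f (Equiv.swap i j * g)‖ = ‖f g‖ := by rw [hf g hi hj, norm_neg]
    rw [h2, h3]; linarith
  · nlinarith
  · nlinarith
  · have p1 : 0 ≤ s⁻¹ * (‖f g‖ ^ 2 + ‖f (Equiv.swap i j * g)‖ ^ 2) := by positivity
    have p2 : 0 ≤ s * (‖f g‖ ^ 2 + ‖f (Equiv.swap i j * g)‖ ^ 2) := by positivity
    nlinarith [sq_nonneg (‖f g - f (Equiv.swap i j * g)‖)]

/-- Terms with both preimages in `R` vanish by symmetry; the others obey `‖x - y‖² ≤ 2‖x‖² + 2‖y‖²`.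
-/
lemma swapEnergy_le {f : Sym n → 𝕜} {R : Finset (Fin n)} {i j : Fin n}
    (hf : ∀ g : Sym n, g⁻¹ i ∈ R → g⁻¹ j ∈ R → f (Equiv.swap i j * g) = f g) :
    swapEnergy f i j ≤ 2 * (mass f R i + mass f R j) := by
  have e : 2 * (mass f R i + mass f R j) =
      ∑ g : Sym n, (((if g⁻¹ i ∈ R then 0 else ‖f g‖ ^ 2) +
            if g⁻¹ j ∈ R then 0 else ‖f (Equiv.swap i j * g)‖ ^ 2)
        + ((if g⁻¹ j ∈ R then 0 else ‖f g‖ ^ 2) +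
            if g⁻¹ i ∈ R then 0 else ‖f (Equiv.swap i j * g)‖ ^ 2)) := by
    simp only [Finset.sum_add_distrib, mass_swap_left, mass_swap_right]
    rw [← mass, ← mass]
    ring
  rw [e, swapEnergy]
  refine Finset.sum_le_sum fun g _ => ?_
  have h1 : ‖f g - f (Equiv.swap i j * g)‖ ^ 2 ≤ (‖f g‖ + ‖f (Equiv.swap i j * g)‖) ^ 2 :=
    pow_le_pow_left₀ (norm_nonneg _) (norm_sub_le _ _) 2
  have h2 := sq_nonneg (‖f g‖ - ‖f (Equiv.swap i j * g)‖)
  by_cases hi : g⁻¹ i ∈ R <;> by_cases hj : g⁻¹ j ∈ R <;> simp only [hi, hj, if_true, if_false]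
  · simp [hf g hi hj]
  all_goals nlinarith

lemma sqNorm_translate (π : Sym n) (f : Sym n → 𝕜) : sqNorm (translate π f) = sqNorm f :=
  Equiv.sum_comp (Equiv.mulLeft π⁻¹) fun g => ‖f g‖ ^ 2

lemma mass_translate (π : Sym n) (f : Sym n → 𝕜) (C : Finset (Fin n)) (i : Fin n) :
    mass (translate π f) C i = mass f C (π⁻¹ i) := by
  rw [mass, mass, ← Equiv.sum_comp (Equiv.mulLeft π)]
  simp [translate]

end Energy

/-! ### Averaging over the permutations that carry one set into another -/

section Averaging

variable {n : ℕ}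

/-- The permutations mapping `T` into `L`. -/
def permsInto (T L : Finset (Fin n)) : Finset (Sym n) := {π | ∀ t ∈ T, π t ∈ L}

lemma permsInto_nonempty {T L : Finset (Fin n)} (h : T.card ≤ L.card) :
    (permsInto T L).Nonempty := by
  obtain ⟨L', hL', hc⟩ := Finset.exists_subset_card_eq h
  let e : {x // x ∈ T} ≃ {x // x ∈ L'} := Finset.equivOfCardEq hc.symm
  refine ⟨e.extendSubtype, ?_⟩
  simp only [permsInto, Finset.mem_filter, Finset.mem_univ, true_and]
  exact fun t ht => hL' (e.extendSubtype_mem t ht)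

lemma sum_permsInto_of_notMem {T L : Finset (Fin n)} {m : Fin n → ℝ} (hm : ∀ i ∉ T, m i = 0)
    {i : Fin n} (hi : i ∉ L) : ∑ π ∈ permsInto T L, m (π⁻¹ i) = 0 := by
  refine Finset.sum_eq_zero fun π hπ => hm _ fun h => hi ?_
  simp only [permsInto, Finset.mem_filter, Finset.mem_univ, true_and] at hπ
  simpa using hπ _ h

/-- Left multiplication by a swap of two letters of `L` preserves `permsInto T L`, so the averaged
mass is uniform on `L`; off `L` it is zero. -/
lemma sum_permsInto_of_mem {T L : Finset (Fin n)} {m : Fin n → ℝ} (hm : ∀ i ∉ T, m i = 0)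
    {i : Fin n} (hi : i ∈ L) :
    (L.card : ℝ) * ∑ π ∈ permsInto T L, m (π⁻¹ i) = (permsInto T L).card * ∑ j, m j := by
  have h1 : ∀ j ∈ L, ∑ π ∈ permsInto T L, m (π⁻¹ j) = ∑ π ∈ permsInto T L, m (π⁻¹ i) := by
    intro j hj
    refine Finset.sum_equiv (Equiv.mulLeft (Equiv.swap i j)) (fun π => ?_) (fun π _ => by simp)
    simp only [permsInto, Finset.mem_filter, Finset.mem_univ, true_and, Equiv.coe_mulLeft,
      Equiv.Perm.mul_apply]
    have h : ∀ x, Equiv.swap i j x ∈ L ↔ x ∈ L := fun x => by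
      rcases eq_or_ne x i with rfl | hxi
      · simp [hi, hj]
      rcases eq_or_ne x j with rfl | hxj
      · simp [hi, hj]
      rw [Equiv.swap_apply_of_ne_of_ne hxi hxj]
    simp only [h]
  calc (L.card : ℝ) * ∑ π ∈ permsInto T L, m (π⁻¹ i)
      = ∑ j ∈ L, ∑ π ∈ permsInto T L, m (π⁻¹ j) := by
        rw [Finset.sum_congr rfl h1, Finset.sum_const, nsmul_eq_mul]
    _ = ∑ j, ∑ π ∈ permsInto T L, m (π⁻¹ j) :=
        Finset.sum_subset (Finset.subset_univ _)
          fun j _ hj => sum_permsInto_of_notMem hm hj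
    _ = (permsInto T L).card * ∑ j, m j := by
        rw [Finset.sum_comm]
        simp_rw [fun π : Sym n => Equiv.sum_comp π⁻¹ m]
        rw [Finset.sum_const, nsmul_eq_mul]

lemma exists_finset_largest (m : Fin n → ℝ) {h : ℕ} (hh : h ≤ n) :
    ∃ H : Finset (Fin n), H.card = h ∧ ∀ i ∉ H, ∀ j ∈ H, m i ≤ m j := by
  induction h with
  | zero => exact ⟨∅, by simp⟩
  | succ h ih =>
    obtain ⟨H, hc, hH⟩ := ih (by omega)
    have hne : (Hᶜ).Nonempty := by
      rw [← Finset.card_pos, Finset.card_compl, Fintype.card_fin]; omega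
    obtain ⟨a, ha, hmax⟩ := Hᶜ.exists_max_image m hne
    rw [Finset.mem_compl] at ha
    refine ⟨insert a H, by rw [Finset.card_insert_of_notMem ha, hc], fun i hi j hj => ?_⟩
    rw [Finset.mem_insert, not_or] at hi
    rcases Finset.mem_insert.1 hj with rfl | hj
    · exact hmax i (Finset.mem_compl.2 hi.2)
    · exact hH i hi.2 j hj

end Averaging

/-! ### Comparison of the two functions pair by pair -/

section Comparison

variable {𝕜 : Type*} [RCLike 𝕜] {n : ℕ}

/-- The light-heavy numerical estimate. -/
lemma mixed_mass_bound {k : ℕ} (hk : 0 < k) {N a b : ℝ}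
    (hb : b ≤ N) (hab : b + 2 * k * (k + 1) * a ≤ k * N) :
    N / (k + 1) ≤ 2 * N - (1 + (1 / (2 * k : ℝ))⁻¹) * a - (1 + 1 / (2 * k : ℝ)) * b := by
  have hk' : (0 : ℝ) < k := by exact_mod_cast hk
  have h1 : (b + 2 * k * a) * (k + 1) ≤ 2 * k * N := by nlinarith
  have h2 : b + 2 * k * a ≤ 2 * k * N / (k + 1) := by rw [le_div_iff₀ (by positivity)]; exact h1
  -- The value `s = 1/(2k)` makes the two coefficients proportional to `2k : 1`, matching the
  -- combination `b + 2ka` bounded in `h2`.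
  have e : (1 + (1 / (2 * k : ℝ))⁻¹) * a + (1 + 1 / (2 * k : ℝ)) * b =
      (1 + 1 / (2 * k : ℝ)) * (b + 2 * k * a) := by field_simp; ring
  have h3 := mul_le_mul_of_nonneg_left h2 (show 0 ≤ 1 + 1 / (2 * k : ℝ) by positivity)
  have e2 : (1 + 1 / (2 * k : ℝ)) * (2 * k * N / (k + 1)) = 2 * N - N / (k + 1) := by
    field_simp; ring
  linarith

/-- The averaged swap energies of translates of a function that is invariant on the right under
permutations of a large set are dominated by those of any function that is anti-invariant under
permutations of a large set. -/
lemma exists_sum_swapEnergy_translate_le {k : ℕ} (hn : 2 ≤ n) (hnk : 4 * k ^ 2 + 4 * k ≤ n)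
    {f w : Sym n → 𝕜} {C R T : Finset (Fin n)} (hf0 : f ≠ 0) (hw0 : w ≠ 0)
    (hC : Cᶜ.card ≤ k) (hR : Rᶜ.card ≤ k) (hT : T.card ≤ 2 * k)
    (hf : ∀ (g : Sym n) (i j : Fin n), i ≠ j → g⁻¹ i ∈ C → g⁻¹ j ∈ C →
      f (Equiv.swap i j * g) = -f g)
    (hw : ∀ (g : Sym n) (i j : Fin n), g⁻¹ i ∈ R → g⁻¹ j ∈ R → w (Equiv.swap i j * g) = w g)
    (hwT : ∀ (g : Sym n) (i : Fin n), w g ≠ 0 → g⁻¹ i ∉ R → i ∈ T) :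
    ∃ P : Finset (Sym n), P.Nonempty ∧
      (∀ i j, i < j → (∑ π ∈ P, swapEnergy (translate π w) i j) * sqNorm f ≤
        P.card * sqNorm w * swapEnergy f i j) ∧
      ∃ i j, i < j ∧ (∑ π ∈ P, swapEnergy (translate π w) i j) * sqNorm f <
        P.card * sqNorm w * swapEnergy f i j := by
  -- `H` is the set of heavy letters; its complement still has at least `2k(k+1)` letters.
  obtain ⟨H, hHc, hH⟩ := exists_finset_largest (mass f C) (h := 2 * k * (k + 1)) (by nlinarith)
  have hLc : Hᶜ.card = n - 2 * k * (k + 1) := by rw [Finset.card_compl, Fintype.card_fin, hHc]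
  have hL1 : 2 * k * (k + 1) ≤ Hᶜ.card := by
    rw [hLc]; apply Nat.le_sub_of_add_le; nlinarith
  have hL2 : 2 ≤ Hᶜ.card := by
    rcases Nat.eq_zero_or_pos k with rfl | hk
    · simpa [hLc] using hn
    · nlinarith
  have hTL : T.card ≤ Hᶜ.card := by nlinarith
  set N := sqNorm f with hN
  set M := sqNorm w with hM
  have hN0 : 0 < N := sqNorm_pos hf0
  have hM0 : 0 < M := sqNorm_pos hw0
  set P := permsInto T Hᶜ with hP
  have hPne : P.Nonempty := permsInto_nonempty hTL
  have hP0 : (0 : ℝ) < P.card := by exact_mod_cast hPne.card_pos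
  have hkR : (0 : ℝ) ≤ k := k.cast_nonneg
  have hL0 : (0 : ℝ) < Hᶜ.card := by exact_mod_cast (by omega : 0 < Hᶜ.card)
  have hL1' : 2 * (k : ℝ) * (k + 1) ≤ Hᶜ.card := by exact_mod_cast hL1
  have hmT : ∀ i ∉ T, mass w R i = 0 := fun i hi => Finset.sum_eq_zero fun g _ => by
    split_ifs with h
    · rfl
    · by_contra hne
      exact hi (hwT g i (fun h0 => hne (by simp [h0])) h)
  have hsumw : ∑ i, mass w R i ≤ k * M := by
    rw [sum_mass]; exact mul_le_mul_of_nonneg_right (by exact_mod_cast hR) hM0.le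
  have hsumf : ∑ i, mass f C i ≤ k * N := by
    rw [sum_mass]; exact mul_le_mul_of_nonneg_right (by exact_mod_cast hC) hN0.le
  -- `S i` is the mass at `i` summed over the translates of `w`: zero on heavy letters, spread
  -- evenly over light ones.
  let S : Fin n → ℝ := fun i => ∑ π ∈ P, mass w R (π⁻¹ i)
  have hSH : ∀ i ∈ H, S i = 0 := fun i hi =>
    sum_permsInto_of_notMem hmT (by simpa using hi)
  have hSL : ∀ i ∉ H, S i ≤ P.card * M * (k / Hᶜ.card) := by
    intro i hi
    have h1 := sum_permsInto_of_mem (T := T) hmT (Finset.mem_compl.2 hi)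
    have h2 : (Hᶜ.card : ℝ) * S i ≤ P.card * (k * M) := by
      rw [h1]; exact mul_le_mul_of_nonneg_left hsumw hP0.le
    have e : (P.card * M * (k / Hᶜ.card) : ℝ) = P.card * (k * M) / Hᶜ.card := by ring
    rw [e, le_div_iff₀ hL0]; linarith
  have hup : ∀ i j, ∑ π ∈ P, swapEnergy (translate π w) i j ≤ 2 * (S i + S j) := by
    intro i j
    rw [← Finset.sum_add_distrib, Finset.mul_sum]
    refine Finset.sum_le_sum fun π _ => ?_
    have h := swapEnergy_le (f := translate π w) (R := R) (i := i) (j := j) (fun g hi hj => by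
      have := hw (π⁻¹ * g) (π⁻¹ i) (π⁻¹ j) (by simpa using hi) (by simpa using hj)
      simp only [translate]
      rw [← this]
      congr 1
      rw [Equiv.swap_apply_apply]
      group)
    simpa only [mass_translate] using h
  have hklt : (2 : ℝ) * (k / Hᶜ.card) * (k + 1) ≤ 1 := by
    have e : (2 : ℝ) * (k / Hᶜ.card) * (k + 1) = (2 * k * (k + 1)) / Hᶜ.card := by ring
    rw [e, div_le_one hL0]; exact hL1'
  have hk2 : 2 * (k / Hᶜ.card : ℝ) ≤ 1 / (k + 1) := by
    rw [le_div_iff₀ (by positivity)]; exact hklt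
  -- light-heavy pairs
  have hmix : ∀ i ∉ H, ∀ j ∈ H, N / (k + 1) ≤ swapEnergy f i j := by
    intro i hi j hj
    have hij : i ≠ j := fun h => hi (h ▸ hj)
    have hk : 0 < k := by
      rcases Nat.eq_zero_or_pos k with rfl | hk
      · simp only [Nat.mul_zero, Nat.zero_mul, Finset.card_eq_zero] at hHc
        simp [hHc] at hj
      · exact hk
    refine (mixed_mass_bound hk (mass_le_sqNorm f C j) ?_).trans
      (le_swapEnergy (s := 1 / (2 * k)) (by positivity) fun g => hf g i j hij)
    refine le_trans ?_ hsumf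
    have h1 : mass f C i + ∑ x ∈ H, mass f C x ≤ ∑ x, mass f C x := by
      rw [← Finset.sum_insert hi]
      exact Finset.sum_le_sum_of_subset_of_nonneg (Finset.subset_univ _)
        fun x _ _ => mass_nonneg f C x
    -- The heavy letter `j` is kept apart: the light `i` and the other `2k(k+1) - 1` heavy letters
    -- supply `2k(k+1)` masses, each at least that of `i`.
    have h2 : ((H.erase j).card : ℝ) * mass f C i ≤ ∑ x ∈ H.erase j, mass f C x := by
      rw [← nsmul_eq_mul]
      exact Finset.card_nsmul_le_sum _ _ _ fun x hx => hH i hi x (Finset.mem_of_mem_erase hx)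
    have h3 : (((H.erase j).card : ℝ) + 1) = 2 * k * (k + 1) := by
      have := Finset.card_erase_add_one hj
      rw [hHc] at this
      exact_mod_cast this
    rw [← Finset.add_sum_erase H _ hj] at h1
    rw [← h3]
    linarith
  -- light-light pairs
  have hlight : ∀ i ∉ H, (2 * k * (k + 1) + 1) * mass f C i ≤ k * N := by
    intro i hi
    refine le_trans ?_ hsumf
    have h1 : mass f C i + ∑ x ∈ H, mass f C x ≤ ∑ x, mass f C x := by
      rw [← Finset.sum_insert hi]
      exact Finset.sum_le_sum_of_subset_of_nonneg (Finset.subset_univ _)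
        fun x _ _ => mass_nonneg f C x
    have h2 : (H.card : ℝ) * mass f C i ≤ ∑ x ∈ H, mass f C x := by
      rw [← nsmul_eq_mul]
      exact Finset.card_nsmul_le_sum _ _ _ fun x hx => hH i hi x hx
    rw [hHc] at h2
    push_cast at h2
    linarith
  have hk4 : 4 * k ≤ 2 * k * (k + 1) := by
    rcases Nat.eq_zero_or_pos k with rfl | hk <;> nlinarith
  have hk4' : (4 : ℝ) * k ≤ 2 * k * (k + 1) := by exact_mod_cast hk4
  -- A light mass is at most `kN/(2k(k+1)+1)`, and `4k ≤ 2k(k+1)`; the extra `1` makes the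
  -- inequality strict.
  have hquarter : ∀ i ∉ H, 4 * mass f C i < N := by
    intro i hi
    have h1 := hlight i hi
    have h0 := mass_nonneg f C i
    by_contra! h2
    have h3 : (k : ℝ) * N ≤ k * (4 * mass f C i) := mul_le_mul_of_nonneg_left h2 hkR
    have h4 : 0 < mass f C i := by linarith
    nlinarith
  have hpure : ∀ i ∉ H, ∀ j ∉ H, i ≠ j → N < swapEnergy f i j := by
    intro i hi j hj hij
    have h1 := le_swapEnergy (s := 1) one_pos fun g => hf g i j hij
    norm_num at h1
    have h2 := hquarter i hi
    have h3 := hquarter j hj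
    linarith
  have hpure' : ∀ i ∉ H, ∀ j ∉ H, i ≠ j →
      (∑ π ∈ P, swapEnergy (translate π w) i j) * N < P.card * M * swapEnergy f i j := by
    intro i hi j hj hij
    have h1 : 4 * (k / Hᶜ.card : ℝ) ≤ 1 := by
      rw [← mul_div_assoc, div_le_one hL0]; linarith
    have hPM : 0 < P.card * M := by positivity
    calc (∑ π ∈ P, swapEnergy (translate π w) i j) * N
        ≤ (2 * (S i + S j)) * N := mul_le_mul_of_nonneg_right (hup i j) hN0.le
      _ ≤ (P.card * M * (4 * (k / Hᶜ.card))) * N := by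
          refine mul_le_mul_of_nonneg_right ?_ hN0.le
          linarith [hSL i hi, hSL j hj]
      _ ≤ P.card * M * N := by
          refine mul_le_mul_of_nonneg_right ?_ hN0.le
          exact mul_le_of_le_one_right hPM.le h1
      _ < P.card * M * swapEnergy f i j :=
          mul_lt_mul_of_pos_left (hpure i hi j hj hij) hPM
  have hmix' : ∀ i ∉ H, ∀ j ∈ H,
      2 * (S i + S j) * N ≤ P.card * M * swapEnergy f i j := by
    intro i hi j hj
    calc 2 * (S i + S j) * N ≤ (P.card * M * (2 * (k / Hᶜ.card))) * N := by
          refine mul_le_mul_of_nonneg_right ?_ hN0.le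
          linarith [hSL i hi, hSH j hj]
      _ ≤ (P.card * M * (1 / (k + 1))) * N := by gcongr
      _ = P.card * M * (N / (k + 1)) := by ring
      _ ≤ P.card * M * swapEnergy f i j :=
          mul_le_mul_of_nonneg_left (hmix i hi j hj) (by positivity)
  refine ⟨P, hPne, fun i j hij => ?_, ?_⟩
  · by_cases hi : i ∈ H <;> by_cases hj : j ∈ H
    -- Both letters are heavy, so every translate of `w` contributes zero energy.
    · have h := mul_le_mul_of_nonneg_right (hup i j) hN0.le
      rw [hSH i hi, hSH j hj] at h
      have := swapEnergy_nonneg f i j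
      have : 0 ≤ P.card * M * swapEnergy f i j := by positivity
      linarith
    · have h := mul_le_mul_of_nonneg_right (hup i j) hN0.le
      have h2 := hmix' j hj i hi
      rw [swapEnergy_comm f, add_comm] at h2
      exact h.trans h2
    · exact (mul_le_mul_of_nonneg_right (hup i j) hN0.le).trans (hmix' i hi j hj)
    · exact (hpure' i hi j hj hij.ne).le
  -- Any two light letters give a strict inequality.
  · obtain ⟨a, ha, b, hb, hab⟩ := Finset.one_lt_card.1 (by omega : 1 < Hᶜ.card)
    rw [Finset.mem_compl] at ha hb
    rcases lt_or_gt_of_ne hab with h | h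
    · exact ⟨a, b, h, hpure' a ha b hb hab⟩
    · exact ⟨b, a, h, hpure' b hb a ha hab.symm⟩

/-- The quadratic form of the Laplacian on functions on the symmetric group. -/
def energy (A : Matrix (Fin n) (Fin n) ℝ) (f : Sym n → 𝕜) : ℝ :=
  ∑ i, ∑ j ∈ Finset.Ioi i, A i j * swapEnergy f i j

/-- If the energies of all translates of `w` are at least `l` times its squared norm, then so is
the energy of `f`. -/
lemma mul_sqNorm_le_energy {P : Finset (Sym n)} (hP : P.Nonempty) {f w : Sym n → 𝕜}
    (hw0 : w ≠ 0) {A : Matrix (Fin n) (Fin n) ℝ} (hA : ∀ i j, i < j → 0 ≤ A i j)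
    (hle : ∀ i j, i < j → (∑ π ∈ P, swapEnergy (translate π w) i j) * sqNorm f ≤
        P.card * sqNorm w * swapEnergy f i j)
    {l : ℝ} (hl : ∀ π, l * sqNorm w ≤ energy A (translate π w)) (hf0 : f ≠ 0) :
    l * sqNorm f ≤ energy A f ∧ ((∃ i j, i < j ∧ 0 < A i j ∧
      (∑ π ∈ P, swapEnergy (translate π w) i j) * sqNorm f <
        P.card * sqNorm w * swapEnergy f i j) → l * sqNorm f < energy A f) := by
  have hN0 : 0 < sqNorm f := sqNorm_pos hf0
  have hM0 : 0 < sqNorm w := sqNorm_pos hw0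
  have hP0 : (0 : ℝ) < P.card := by exact_mod_cast hP.card_pos
  have hPM : 0 < P.card * sqNorm w := by positivity
  have h1 : P.card * (l * sqNorm w) ≤ ∑ π ∈ P, energy A (translate π w) := by
    rw [← nsmul_eq_mul]; exact Finset.card_nsmul_le_sum _ _ _ fun π _ => hl π
  have e1 : (∑ π ∈ P, energy A (translate π w)) * sqNorm f = ∑ i, ∑ j ∈ Finset.Ioi i,
      A i j * ((∑ π ∈ P, swapEnergy (translate π w) i j) * sqNorm f) := by
    simp only [energy]
    rw [Finset.sum_comm, Finset.sum_mul]
    refine Finset.sum_congr rfl fun i _ => ?_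
    rw [Finset.sum_comm, Finset.sum_mul]
    refine Finset.sum_congr rfl fun j _ => ?_
    rw [← Finset.mul_sum, mul_assoc]
  have e2 : P.card * sqNorm w * energy A f = ∑ i, ∑ j ∈ Finset.Ioi i,
      A i j * (P.card * sqNorm w * swapEnergy f i j) := by
    simp only [energy, Finset.mul_sum]
    exact Finset.sum_congr rfl fun i _ => Finset.sum_congr rfl fun j _ => by ring
  have h2 : P.card * sqNorm w * (l * sqNorm f) ≤
      (∑ π ∈ P, energy A (translate π w)) * sqNorm f := by
    have := mul_le_mul_of_nonneg_right h1 hN0.le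
    linarith
  have hterm : ∀ i, ∀ j ∈ Finset.Ioi i,
      A i j * ((∑ π ∈ P, swapEnergy (translate π w) i j) * sqNorm f) ≤
        A i j * (P.card * sqNorm w * swapEnergy f i j) := fun i j hj =>
    mul_le_mul_of_nonneg_left (hle i j (Finset.mem_Ioi.1 hj)) (hA i j (Finset.mem_Ioi.1 hj))
  constructor
  · refine le_of_mul_le_mul_left ?_ hPM
    rw [e2]
    rw [e1] at h2
    exact h2.trans (Finset.sum_le_sum fun i _ => Finset.sum_le_sum (hterm i))
  · rintro ⟨i, j, hij, hAij, hlt⟩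
    refine lt_of_mul_lt_mul_left ?_ hPM.le
    rw [e2]
    rw [e1] at h2
    refine h2.trans_lt (Finset.sum_lt_sum (fun i _ => Finset.sum_le_sum (hterm i))
      ⟨i, Finset.mem_univ i, Finset.sum_lt_sum (hterm i) ⟨j, Finset.mem_Ioi.2 hij, ?_⟩⟩)
    exact mul_lt_mul_of_pos_left hlt hAij

end Comparison

/-! ### The Laplacian on the group ring and its Rayleigh quotients -/

section Laplacian

variable {𝕜 : Type*} [RCLike 𝕜] {n : ℕ}

lemma coeff_of_mul (π : Sym n) (x : 𝕜[Sym n]) :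
    ⇑(MonoidAlgebra.of 𝕜 (Sym n) π * x).coeff = translate π x.coeff := by
  ext g
  simp [MonoidAlgebra.of, MonoidAlgebra.coeff_single_mul_apply, translate]

lemma coeff_mul_of (π g : Sym n) (x : 𝕜[Sym n]) :
    (x * MonoidAlgebra.of 𝕜 (Sym n) π).coeff g = x.coeff (g * π⁻¹) := by
  simp [MonoidAlgebra.of, MonoidAlgebra.coeff_mul_single_apply]

/-- The standard inner product on the group ring. -/
def pairing (x y : 𝕜[Sym n]) : 𝕜 := ∑ g, (starRingEnd 𝕜) (x.coeff g) * y.coeff g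

lemma pairing_self (x : 𝕜[Sym n]) : pairing x x = (sqNorm x.coeff : 𝕜) := by
  simp [pairing, sqNorm, RCLike.conj_mul]

lemma pairing_sum_left {ι : Type*} (s : Finset ι) (x : ι → 𝕜[Sym n]) (y : 𝕜[Sym n]) :
    pairing (∑ i ∈ s, x i) y = ∑ i ∈ s, pairing (x i) y := by
  simp only [pairing, MonoidAlgebra.coeff_sum, Finsupp.finsetSum_apply, map_sum, Finset.sum_mul]
  exact Finset.sum_comm

lemma pairing_sum_right {ι : Type*} (s : Finset ι) (x : 𝕜[Sym n]) (y : ι → 𝕜[Sym n]) :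
    pairing x (∑ i ∈ s, y i) = ∑ i ∈ s, pairing x (y i) := by
  simp only [pairing, MonoidAlgebra.coeff_sum, Finsupp.finsetSum_apply, Finset.mul_sum]
  exact Finset.sum_comm

lemma pairing_smul_left (c : 𝕜) (x y : 𝕜[Sym n]) :
    pairing (c • x) y = (starRingEnd 𝕜) c * pairing x y := by
  simp [pairing, Finset.mul_sum, mul_assoc]

lemma pairing_smul_right (c : 𝕜) (x y : 𝕜[Sym n]) : pairing x (c • y) = c * pairing x y := by
  simp [pairing, Finset.mul_sum, mul_left_comm]

lemma pairing_sub_left (x x' y : 𝕜[Sym n]) :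
    pairing (x - x') y = pairing x y - pairing x' y := by
  simp [pairing, sub_mul]

lemma pairing_sub_right (x y y' : 𝕜[Sym n]) :
    pairing x (y - y') = pairing x y - pairing x y' := by
  simp [pairing, mul_sub]

lemma pairing_of_mul (π : Sym n) (x y : 𝕜[Sym n]) :
    pairing (MonoidAlgebra.of 𝕜 (Sym n) π * x) y =
      pairing x (MonoidAlgebra.of 𝕜 (Sym n) π⁻¹ * y) := by
  simp only [pairing, coeff_of_mul, translate, inv_inv]
  rw [← Equiv.sum_comp (Equiv.mulLeft π)]
  simp

lemma pairing_mul_of (π : Sym n) (x y : 𝕜[Sym n]) :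
    pairing (x * MonoidAlgebra.of 𝕜 (Sym n) π) y =
      pairing x (y * MonoidAlgebra.of 𝕜 (Sym n) π⁻¹) := by
  simp only [pairing, coeff_mul_of, inv_inv]
  rw [← Equiv.sum_comp (Equiv.mulRight π)]
  simp

lemma pairing_laplacian_mul (A : Matrix (Fin n) (Fin n) ℝ) (x y : 𝕜[Sym n]) :
    pairing (laplacian 𝕜 A * x) y = pairing x (laplacian 𝕜 A * y) := by
  simp only [laplacian, Finset.sum_mul, pairing_sum_left, pairing_sum_right, smul_mul_assoc,
    pairing_smul_left, pairing_smul_right, sub_mul, one_mul, pairing_sub_left, pairing_sub_right,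
    pairing_of_mul, RCLike.conj_ofReal, Equiv.swap_inv]

/-- Averaging the sum with its reindexing by `g ↦ swap * g` completes the square. -/
lemma re_pairing_sub_swap (x : 𝕜[Sym n]) (i j : Fin n) :
    RCLike.re (pairing (x - MonoidAlgebra.of 𝕜 (Sym n) (Equiv.swap i j) * x) x) =
      swapEnergy x.coeff i j := by
  have h1 : RCLike.re (pairing (x - MonoidAlgebra.of 𝕜 (Sym n) (Equiv.swap i j) * x) x) =
      ∑ g : Sym n, RCLike.re ((starRingEnd 𝕜) (x.coeff g - x.coeff (Equiv.swap i j * g)) *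
        x.coeff g) := by
    simp [pairing]
  have h2 : ∑ g : Sym n, RCLike.re ((starRingEnd 𝕜)
      (x.coeff g - x.coeff (Equiv.swap i j * g)) * x.coeff g) =
      ∑ g : Sym n, RCLike.re ((starRingEnd 𝕜) (x.coeff (Equiv.swap i j * g) - x.coeff g) *
        x.coeff (Equiv.swap i j * g)) := by
    rw [← Equiv.sum_comp (Equiv.mulLeft (Equiv.swap i j))]
    simp
  have h3 : swapEnergy x.coeff i j = 1 / 2 * (∑ g : Sym n, RCLike.re ((starRingEnd 𝕜)
      (x.coeff g - x.coeff (Equiv.swap i j * g)) * x.coeff g) +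
      ∑ g : Sym n, RCLike.re ((starRingEnd 𝕜) (x.coeff (Equiv.swap i j * g) - x.coeff g) *
        x.coeff (Equiv.swap i j * g))) := by
    rw [← Finset.sum_add_distrib, Finset.mul_sum, swapEnergy]
    refine Finset.sum_congr rfl fun g _ => ?_
    congr 1
    rw [← RCLike.ofReal_re (K := 𝕜) (‖_‖ ^ 2), RCLike.ofReal_pow, ← RCLike.conj_mul, ← map_add]
    congr 1
    simp only [map_sub]
    ring
  rw [h1, h3, ← h2]
  ring

lemma re_pairing_laplacian_mul (A : Matrix (Fin n) (Fin n) ℝ) (x : 𝕜[Sym n]) :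
    RCLike.re (pairing (laplacian 𝕜 A * x) x) = energy A x.coeff := by
  simp only [laplacian, Finset.sum_mul, pairing_sum_left, smul_mul_assoc, pairing_smul_left,
    sub_mul, one_mul, RCLike.conj_ofReal, map_sum, RCLike.re_ofReal_mul, re_pairing_sub_swap,
    energy]

lemma energy_of_laplacian_mul_eq {A : Matrix (Fin n) (Fin n) ℝ} {x : 𝕜[Sym n]} {l : ℝ}
    (h : laplacian 𝕜 A * x = (l : 𝕜) • x) : energy A x.coeff = l * sqNorm x.coeff := by
  rw [← re_pairing_laplacian_mul, h, pairing_smul_left, pairing_self, RCLike.conj_ofReal,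
    RCLike.re_ofReal_mul, RCLike.ofReal_re]

/-- The group ring as a Euclidean space. -/
def toEuclidean : 𝕜[Sym n] ≃ₗ[𝕜] EuclideanSpace 𝕜 (Sym n) where
  toFun x := WithLp.toLp 2 x.coeff
  invFun f := MonoidAlgebra.ofCoeff (Finsupp.equivFunOnFinite.symm f.ofLp)
  left_inv x := by ext; simp
  right_inv f := by ext; simp
  map_add' x y := by ext; simp
  map_smul' c x := by ext; simp

lemma inner_toEuclidean (x y : 𝕜[Sym n]) : ⟪toEuclidean x, toEuclidean y⟫_𝕜 = pairing x y := by
  simp [toEuclidean, PiLp.inner_apply, pairing, mul_comm]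

lemma norm_toEuclidean_sq (x : 𝕜[Sym n]) : ‖toEuclidean x‖ ^ 2 = sqNorm x.coeff := by
  simp [toEuclidean, EuclideanSpace.norm_sq_eq, sqNorm]

lemma energy_nonneg {A : Matrix (Fin n) (Fin n) ℝ} (hA : ∀ i j, i < j → 0 ≤ A i j)
    (f : Sym n → 𝕜) : 0 ≤ energy A f :=
  Finset.sum_nonneg fun i _ => Finset.sum_nonneg fun j hj =>
    mul_nonneg (hA i j (Finset.mem_Ioi.1 hj)) (swapEnergy_nonneg f i j)

/-- The Rayleigh principle in a left ideal of the group ring. -/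
lemma exists_eigenvector_le {A : Matrix (Fin n) (Fin n) ℝ} (hA : ∀ i j, i < j → 0 ≤ A i j)
    (J : Ideal 𝕜[Sym n]) {w : 𝕜[Sym n]} (hw : w ∈ J) (hw0 : w ≠ 0) :
    ∃ l : ℝ, ∃ x ∈ J, x ≠ 0 ∧ laplacian 𝕜 A * x = (l : 𝕜) • x ∧
      l * sqNorm w.coeff ≤ energy A w.coeff := by
  let D : EuclideanSpace 𝕜 (Sym n) →ₗ[𝕜] EuclideanSpace 𝕜 (Sym n) :=
    toEuclidean.conj (LinearMap.mulLeft 𝕜 (laplacian 𝕜 A))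
  have hD : ∀ x, D (toEuclidean x) = toEuclidean (laplacian 𝕜 A * x) := fun x => by
    simp [D, LinearEquiv.conj_apply]
  have hsymm : D.IsSymmetric := fun f h => by
    obtain ⟨x, rfl⟩ := toEuclidean.surjective f
    obtain ⟨y, rfl⟩ := toEuclidean.surjective h
    rw [hD, hD, inner_toEuclidean, inner_toEuclidean, pairing_laplacian_mul]
  let K : Submodule 𝕜 (EuclideanSpace 𝕜 (Sym n)) :=
    (J.restrictScalars 𝕜).map (toEuclidean (𝕜 := 𝕜) (n := n)).toLinearMap
  have hK : ∀ f ∈ K, D f ∈ K := by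
    rintro f ⟨x, hx, rfl⟩
    exact ⟨laplacian 𝕜 A * x, J.mul_mem_left _ hx, (hD x).symm⟩
  let w' : K := ⟨toEuclidean w, w, hw, rfl⟩
  have hw' : w' ≠ 0 := fun h => hw0 (by simpa [w'] using congrArg Subtype.val h)
  have : Nontrivial K := ⟨w', 0, hw'⟩
  have heig := (hsymm.restrict_invariant hK).hasEigenvalue_iInf_of_finiteDimensional
  obtain ⟨⟨f, x, hx, hxf⟩, hf⟩ := heig.exists_hasEigenvector
  -- Non-negative weights bound the Rayleigh quotients below by `0`, as `ciInf_le` requires.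
  have hray : ∀ y : K, 0 ≤ RCLike.re ⟪D.restrict hK y, y⟫_𝕜 := by
    rintro ⟨_, x, hx, rfl⟩
    change 0 ≤ RCLike.re ⟪D (toEuclidean x), toEuclidean x⟫_𝕜
    rw [hD, inner_toEuclidean, re_pairing_laplacian_mul]
    exact energy_nonneg hA _
  refine ⟨⨅ x : {x : K // x ≠ 0}, RCLike.re ⟪D.restrict hK x, x⟫_𝕜 / ‖(x : K)‖ ^ 2,
    x, hx, ?_, ?_, ?_⟩
  rotate_left 2
  · have hle := ciInf_le (f := fun x : {x : K // x ≠ 0} =>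
      RCLike.re ⟪D.restrict hK x, x⟫_𝕜 / ‖(x : K)‖ ^ 2)
      ⟨0, by rintro _ ⟨y, rfl⟩; exact div_nonneg (hray _) (by positivity)⟩ ⟨w', hw'⟩
    have hpos : 0 < ‖w'‖ ^ 2 := by have := norm_pos_iff.2 hw'; positivity
    rw [le_div_iff₀ hpos] at hle
    have e1 : ‖w'‖ ^ 2 = sqNorm w.coeff := norm_toEuclidean_sq w
    have e2 : RCLike.re ⟪D.restrict hK w', w'⟫_𝕜 = energy A w.coeff := by
      change RCLike.re ⟪D (toEuclidean w), toEuclidean w⟫_𝕜 = _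
      rw [hD, inner_toEuclidean, re_pairing_laplacian_mul]
    rw [← e1, ← e2]
    exact hle
  · rintro rfl
    exact hf.2 (Subtype.ext (by simp [← hxf]))
  · have h := congrArg Subtype.val hf.apply_eq_smul
    subst hxf
    refine toEuclidean.injective ?_
    rw [← hD, map_smul]
    exact h

end Laplacian

/-! ### Eigenvalues under intertwining maps -/

section Transfer

variable {𝕜 : Type*} [RCLike 𝕜] {n : ℕ}
  {V : Type*} [AddCommGroup V] [Module 𝕜 V] {W : Type*} [AddCommGroup W] [Module 𝕜 W]

lemma asAlgebraHom_intertwine {ρ : Representation 𝕜 (Sym n) V} {σ : Representation 𝕜 (Sym n) W}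
    (φ : V →ₗ[𝕜] W) (hφ : ∀ g v, φ (ρ g v) = σ g (φ v)) (x : 𝕜[Sym n]) (v : V) :
    φ (ρ.asAlgebraHom x v) = σ.asAlgebraHom x (φ v) := by
  induction x using MonoidAlgebra.induction_on with
  | of g => simp [hφ]
  | add x y hx hy => simp [hx, hy]
  | smul r x hx => simp [hx]

lemma eigenvalueSet_subset {ρ : Representation 𝕜 (Sym n) V} {σ : Representation 𝕜 (Sym n) W}
    (φ : V →ₗ[𝕜] W) (hinj : Function.Injective φ) (hφ : ∀ g v, φ (ρ g v) = σ g (φ v))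
    (A : Matrix (Fin n) (Fin n) ℝ) : eigenvalueSet A ρ ⊆ eigenvalueSet A σ := by
  intro l hl
  obtain ⟨v, hv⟩ := Module.End.HasEigenvalue.exists_hasEigenvector hl
  refine Module.End.hasEigenvalue_of_hasEigenvector (x := φ v) ?_
  rw [Module.End.hasEigenvector_iff, Module.End.mem_eigenspace_iff]
  exact ⟨by rw [← asAlgebraHom_intertwine φ hφ, hv.apply_eq_smul, map_smul],
    fun h => hv.2 (hinj (by rw [h, map_zero]))⟩

lemma eigenvalueSet_congr {ρ : Representation 𝕜 (Sym n) V} {σ : Representation 𝕜 (Sym n) W}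
    (φ : ρ.Equiv σ) (A : Matrix (Fin n) (Fin n) ℝ) : eigenvalueSet A ρ = eigenvalueSet A σ := by
  have h : ∀ g v, φ.toLinearEquiv (ρ g v) = σ g (φ.toLinearEquiv v) := fun g v =>
    LinearMap.congr_fun (φ.isIntertwining' g) v
  refine (eigenvalueSet_subset φ.toLinearEquiv.toLinearMap φ.toLinearEquiv.injective h A).antisymm
    (eigenvalueSet_subset φ.toLinearEquiv.symm.toLinearMap φ.toLinearEquiv.symm.injective
      (fun g v => φ.toLinearEquiv.injective ?_) A)
  rw [h]
  simp only [LinearEquiv.coe_coe, LinearEquiv.apply_symm_apply]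

lemma asAlgebraHom_ofModule' (J : Ideal 𝕜[Sym n]) (x : 𝕜[Sym n]) (u : J) :
    (Representation.ofModule' (k := 𝕜) (G := Sym n) J).asAlgebraHom x u = x • u := by
  simp [Representation.ofModule', Representation.asAlgebraHom]

lemma mem_eigenvalueSet_ofModule' {J : Ideal 𝕜[Sym n]} {A : Matrix (Fin n) (Fin n) ℝ} {l : ℝ} :
    l ∈ eigenvalueSet A (Representation.ofModule' (k := 𝕜) (G := Sym n) J) ↔
      ∃ x ∈ J, x ≠ 0 ∧ laplacian 𝕜 A * x = (l : 𝕜) • x := by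
  constructor
  · intro hl
    obtain ⟨v, hv⟩ := Module.End.HasEigenvalue.exists_hasEigenvector hl
    refine ⟨v, v.2, fun h => hv.2 (Subtype.ext h), ?_⟩
    have := hv.apply_eq_smul
    rw [asAlgebraHom_ofModule'] at this
    exact congrArg Subtype.val this
  · rintro ⟨x, hx, hx0, h⟩
    refine Module.End.hasEigenvalue_of_hasEigenvector (x := (⟨x, hx⟩ : J)) ?_
    rw [Module.End.hasEigenvector_iff, Module.End.mem_eigenspace_iff, asAlgebraHom_ofModule']
    exact ⟨Subtype.ext h, fun h0 => hx0 (congrArg Subtype.val h0)⟩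

end Transfer

/-! ### Row and column sums of a numbering, and the two symmetrizers -/

section Tableaux

variable {𝕜 : Type*} [RCLike 𝕜] {n : ℕ} {μ : YoungDiagram} (T : Fin n ≃ μ.cells)

lemma eq_of_rowOf_eq_of_colOf_eq {x y : Fin n} (h1 : rowOf T x = rowOf T y)
    (h2 : colOf T x = colOf T y) : x = y :=
  T.injective (Subtype.ext (Prod.ext h1 h2))

/-- The letters in the first row. -/
def firstRow : Finset (Fin n) := {x | rowOf T x = 0}

/-- The letters in the first column. -/
def firstCol : Finset (Fin n) := {x | colOf T x = 0}

/-- The letters in the columns that meet the complement of the first row. -/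
def deepCols : Finset (Fin n) :=
  (Finset.univ.filter fun y => ∃ x, rowOf T x ≠ 0 ∧ colOf T y = colOf T x)

lemma mem_firstRow {x : Fin n} : x ∈ firstRow T ↔ rowOf T x = 0 := by simp [firstRow]

lemma mem_firstCol {x : Fin n} : x ∈ firstCol T ↔ colOf T x = 0 := by simp [firstCol]

lemma card_firstRow : (firstRow T).card = μ.rowLen 0 := by
  rw [μ.rowLen_eq_card, ← Finset.card_image_of_injective (firstRow T)
    (f := fun x => ((T x).1 : ℕ × ℕ)) (Subtype.val_injective.comp T.injective)]
  congr 1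
  ext c
  simp only [mem_firstRow, Finset.mem_image, YoungDiagram.mem_row_iff, rowOf]
  constructor
  · rintro ⟨x, hx, rfl⟩
    exact ⟨(T x).2, hx⟩
  · rintro ⟨hc, h0⟩
    exact ⟨T.symm ⟨c, hc⟩, by simpa using h0, by simp⟩

lemma card_firstCol : (firstCol T).card = μ.colLen 0 := by
  rw [μ.colLen_eq_card, ← Finset.card_image_of_injective (firstCol T)
    (f := fun x => ((T x).1 : ℕ × ℕ)) (Subtype.val_injective.comp T.injective)]
  congr 1
  ext c
  simp only [mem_firstCol, Finset.mem_image, YoungDiagram.mem_col_iff, colOf]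
  constructor
  · rintro ⟨x, hx, rfl⟩
    exact ⟨(T x).2, hx⟩
  · rintro ⟨hc, h0⟩
    exact ⟨T.symm ⟨c, hc⟩, by simpa using h0, by simp⟩

/-- Besides the letters below the first row, each column they meet adds one letter of the first row.
-/
lemma card_deepCols_le : (deepCols T).card ≤ 2 * (firstRow T)ᶜ.card := by
  have hsub : deepCols T ⊆ (firstRow T)ᶜ ∪ (deepCols T ∩ firstRow T) := fun x hx => by
    by_cases h : x ∈ firstRow T <;> simp [h, hx]
  have hcol : (deepCols T ∩ firstRow T).card ≤ ((firstRow T)ᶜ.image (colOf T)).card := by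
    refine Finset.card_le_card_of_injOn (colOf T) (fun y hy => ?_) (fun y hy z hz h => ?_)
    · simp only [deepCols, Finset.mem_coe, Finset.mem_inter, Finset.mem_filter, Finset.mem_univ,
        true_and] at hy
      obtain ⟨⟨x, hx, hyx⟩, -⟩ := hy
      exact Finset.mem_image.2 ⟨x, by simpa [firstRow] using hx, hyx.symm⟩
    · simp only [firstRow, Finset.mem_coe, Finset.mem_inter, Finset.mem_filter, Finset.mem_univ,
        true_and] at hy hz
      exact eq_of_rowOf_eq_of_colOf_eq T (hy.2.trans hz.2.symm) h
  have h1 := Finset.card_le_card hsub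
  have h2 := Finset.card_union_le (firstRow T)ᶜ (deepCols T ∩ firstRow T)
  have h3 := (firstRow T)ᶜ.card_image_le (f := colOf T)
  omega

lemma preserves_mul_iff {α : Type*} {c : Fin n → α} {v : Sym n} (hv : ∀ x, c (v x) = c x)
    (w : Sym n) : (∀ x, c ((w * v) x) = c x) ↔ ∀ x, c (w x) = c x := by
  constructor
  · intro h x
    obtain ⟨y, rfl⟩ := v.surjective x
    rw [hv, ← h y, Equiv.Perm.mul_apply]
  · intro h x
    rw [Equiv.Perm.mul_apply, h, hv]

lemma preserves_inv_iff {α : Type*} {c : Fin n → α} (w : Sym n) :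
    (∀ x, c (w⁻¹ x) = c x) ↔ ∀ x, c (w x) = c x := by
  constructor <;> intro h x
  · have := h (w x); simpa using this.symm
  · have := h (w⁻¹ x); simpa using this.symm

lemma preserves_swap {α : Type*} {c : Fin n → α} {i j : Fin n} (h : c i = c j) (x : Fin n) :
    c (Equiv.swap i j x) = c x := by
  rcases eq_or_ne x i with rfl | hi
  · rw [Equiv.swap_apply_left, h]
  rcases eq_or_ne x j with rfl | hj
  · rw [Equiv.swap_apply_right, h]
  rw [Equiv.swap_apply_of_ne_of_ne hi hj]

lemma rowSum_mul_of {h : Sym n} (hh : ∀ x, rowOf T (h x) = rowOf T x) :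
    rowSum 𝕜 T * MonoidAlgebra.of 𝕜 (Sym n) h = rowSum 𝕜 T := by
  rw [rowSum, Finset.sum_mul]
  refine Finset.sum_equiv (Equiv.mulRight h) (fun g => ?_) (fun g _ => ?_)
  · simp only [Finset.mem_filter, Finset.mem_univ, true_and, Equiv.coe_mulRight]
    exact (preserves_mul_iff hh g).symm
  · rw [← map_mul]; rfl

lemma colSum_mul_of {v : Sym n} (hv : ∀ x, colOf T (v x) = colOf T x) :
    colSum 𝕜 T * MonoidAlgebra.of 𝕜 (Sym n) v =
      ((Equiv.Perm.sign v : ℤ) : 𝕜) • colSum 𝕜 T := by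
  rw [colSum, Finset.sum_mul, Finset.smul_sum]
  refine Finset.sum_equiv (Equiv.mulRight v) (fun g => ?_) (fun g _ => ?_)
  · simp only [Finset.mem_filter, Finset.mem_univ, true_and, Equiv.coe_mulRight]
    exact (preserves_mul_iff hv g).symm
  · rw [smul_mul_assoc, ← map_mul, smul_smul, Equiv.coe_mulRight, Equiv.Perm.sign_mul]
    congr 1
    rcases Int.units_eq_one_or (Equiv.Perm.sign v) with h | h <;> simp [h]

open Classical in
lemma rowSum_mul_rowSum : ∃ c : ℕ,
    rowSum 𝕜 T * rowSum 𝕜 T = (c : 𝕜) • rowSum 𝕜 T := by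
  refine ⟨(Finset.univ.filter fun h : Sym n => ∀ x, rowOf T (h x) = rowOf T x).card, ?_⟩
  conv_lhs => rw [rowSum.eq_1 𝕜 T]
  rw [← rowSum]
  conv_lhs => arg 2; rw [rowSum]
  rw [Finset.mul_sum, Finset.sum_congr rfl fun h hh => rowSum_mul_of T (Finset.mem_filter.1 hh).2,
    Finset.sum_const, Nat.cast_smul_eq_nsmul]

lemma pairing_mul_rowSum (x y : 𝕜[Sym n]) :
    pairing (x * rowSum 𝕜 T) y = pairing x (y * rowSum 𝕜 T) := by
  simp only [rowSum, Finset.mul_sum, pairing_sum_left, pairing_sum_right, pairing_mul_of]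
  refine Finset.sum_equiv (Equiv.inv _) (fun g => ?_) (fun g _ => rfl)
  simp only [Finset.mem_filter, Finset.mem_univ, true_and, Equiv.inv_apply]
  exact (preserves_inv_iff g).symm

lemma pairing_mul_colSum (x y : 𝕜[Sym n]) :
    pairing (x * colSum 𝕜 T) y = pairing x (y * colSum 𝕜 T) := by
  simp only [colSum, Finset.mul_sum, pairing_sum_left, pairing_sum_right, mul_smul_comm,
    pairing_smul_left, pairing_smul_right, pairing_mul_of]
  refine Finset.sum_equiv (Equiv.inv _) (fun g => ?_) (fun g _ => ?_)
  · simp only [Finset.mem_filter, Finset.mem_univ, true_and, Equiv.inv_apply]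
    exact (preserves_inv_iff g).symm
  · simp

lemma coeff_rowSum_eq_zero {g : Sym n} (hg : ¬ ∀ x, rowOf T (g x) = rowOf T x) :
    (rowSum 𝕜 T).coeff g = 0 := by
  rw [rowSum, MonoidAlgebra.coeff_sum, Finsupp.finsetSum_apply]
  refine Finset.sum_eq_zero fun h hh => ?_
  have : h ≠ g := fun e => hg (e ▸ (Finset.mem_filter.1 hh).2)
  simp [MonoidAlgebra.of, this]

lemma coeff_rowSum_one : (rowSum 𝕜 T).coeff 1 = 1 := by
  classical
  rw [rowSum, MonoidAlgebra.coeff_sum, Finsupp.finsetSum_apply,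
    Finset.sum_eq_single_of_mem 1 (by simp) (fun h _ h1 => by simp [MonoidAlgebra.of, h1])]
  simp [MonoidAlgebra.of]

lemma coeff_colSum_mul (x : 𝕜[Sym n]) (g : Sym n) [DecidablePred fun v : Sym n =>
      ∀ x, colOf T (v x) = colOf T x] :
    (colSum 𝕜 T * x).coeff g =
      ∑ v : Sym n with ∀ x, colOf T (v x) = colOf T x,
        ((Equiv.Perm.sign v : ℤ) : 𝕜) * x.coeff (v⁻¹ * g) := by
  simp only [colSum, Finset.sum_mul, smul_mul_assoc, MonoidAlgebra.coeff_sum,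
    Finsupp.finsetSum_apply, MonoidAlgebra.coeff_smul, Finsupp.smul_apply, coeff_of_mul,
    translate, smul_eq_mul]
  congr!

/-- The symmetrizer in the opposite order. -/
def oppositeSymmetrizer : 𝕜[Sym n] := colSum 𝕜 T * rowSum 𝕜 T

/-- Only the identity preserves both rows and columns, so the coefficient at the identity is `1`. -/
lemma oppositeSymmetrizer_ne_zero : (oppositeSymmetrizer T : 𝕜[Sym n]) ≠ 0 := by
  classical
  intro h
  have h1 : (oppositeSymmetrizer T : 𝕜[Sym n]).coeff 1 = 1 := by
    rw [oppositeSymmetrizer, coeff_colSum_mul,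
      Finset.sum_eq_single_of_mem 1 (by simp) (fun v hv hv1 => ?_)]
    · simp [coeff_rowSum_one]
    · rw [coeff_rowSum_eq_zero, mul_zero]
      intro hr
      rw [mul_one] at hr
      refine hv1 (Equiv.ext fun x => ?_)
      exact eq_of_rowOf_eq_of_colOf_eq T ((preserves_inv_iff v).1 hr x)
        ((Finset.mem_filter.1 hv).2 x)
  rw [h] at h1
  simp at h1

/-- A permutation in the support factors as `g = v h` with `v` preserving columns and `h` preserving
rows. Then `v⁻¹ i = h (g⁻¹ i)` is below the first row and shares its column with `i`. -/
lemma mem_deepCols_of_coeff_ne_zero {g : Sym n} {i : Fin n}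
    (hg : (oppositeSymmetrizer T : 𝕜[Sym n]).coeff g ≠ 0) (hi : g⁻¹ i ∉ firstRow T) :
    i ∈ deepCols T := by
  classical
  rw [oppositeSymmetrizer, coeff_colSum_mul] at hg
  obtain ⟨v, hv, hne⟩ := Finset.exists_ne_zero_of_sum_ne_zero hg
  have hv' := (Finset.mem_filter.1 hv).2
  have hr : ∀ x, rowOf T ((v⁻¹ * g) x) = rowOf T x := by
    by_contra hr
    exact hne (by rw [coeff_rowSum_eq_zero T hr, mul_zero])
  refine Finset.mem_filter.2 ⟨Finset.mem_univ _, v⁻¹ i, ?_, ?_⟩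
  · have : rowOf T ((v⁻¹ * g * g⁻¹) i) = rowOf T (g⁻¹ i) := hr (g⁻¹ i)
    rw [mul_assoc, mul_inv_cancel, mul_one] at this
    rw [this]
    simpa [firstRow] using hi
  · exact ((preserves_inv_iff v).2 hv' i).symm

/-- This turns a left swap of letters into a right swap of their preimages, where the symmetry of
the ideals acts. -/
lemma swap_mul_eq (g : Sym n) (i j : Fin n) :
    Equiv.swap i j * g = g * Equiv.swap (g⁻¹ i) (g⁻¹ j) := by
  rw [Equiv.swap_apply_apply]; group

lemma coeff_swap_mul_of_mem_span_opposite {x : 𝕜[Sym n]}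
    (hx : x ∈ Ideal.span {(oppositeSymmetrizer T : 𝕜[Sym n])}) (g : Sym n) (i j : Fin n)
    (hi : g⁻¹ i ∈ firstRow T) (hj : g⁻¹ j ∈ firstRow T) :
    x.coeff (Equiv.swap i j * g) = x.coeff g := by
  obtain ⟨z, rfl⟩ := Ideal.mem_span_singleton'.1 hx
  simp only [firstRow, Finset.mem_filter, Finset.mem_univ, true_and] at hi hj
  have h := rowSum_mul_of (𝕜 := 𝕜) T (preserves_swap (hi.trans hj.symm))
  rw [swap_mul_eq, oppositeSymmetrizer, ← mul_assoc]
  conv_rhs => rw [← h, ← mul_assoc, coeff_mul_of, Equiv.swap_inv]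

lemma coeff_swap_mul_of_mem_span {x : 𝕜[Sym n]}
    (hx : x ∈ Ideal.span {youngSymmetrizer 𝕜 T}) (g : Sym n) (i j : Fin n) (hij : i ≠ j)
    (hi : g⁻¹ i ∈ firstCol T) (hj : g⁻¹ j ∈ firstCol T) :
    x.coeff (Equiv.swap i j * g) = -x.coeff g := by
  obtain ⟨z, rfl⟩ := Ideal.mem_span_singleton'.1 hx
  simp only [firstCol, Finset.mem_filter, Finset.mem_univ, true_and] at hi hj
  have h := colSum_mul_of (𝕜 := 𝕜) T (preserves_swap (hi.trans hj.symm))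
  rw [Equiv.Perm.sign_swap (fun e => hij (g⁻¹.injective e))] at h
  have h' : z * youngSymmetrizer 𝕜 T =
      -(z * youngSymmetrizer 𝕜 T * MonoidAlgebra.of 𝕜 (Sym n)
        (Equiv.swap (g⁻¹ i) (g⁻¹ j))) := by
    rw [youngSymmetrizer, mul_assoc z, mul_assoc (rowSum 𝕜 T), h]
    simp
  rw [swap_mul_eq]
  conv_rhs => rw [h', MonoidAlgebra.coeff_neg, Finsupp.neg_apply, coeff_mul_of, Equiv.swap_inv,
    neg_neg]

/-- Right multiplications by `a` and by `b` are self-adjoint and `a² = c a`, so for `x = zba` one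
has `⟨x, x⟩ = ⟨xa, zb⟩ = c⟨x, zb⟩ = c⟨xb, z⟩ = 0`. -/
lemma eq_zero_of_mul_colSum_eq_zero {x : 𝕜[Sym n]}
    (hx : x ∈ Ideal.span {(oppositeSymmetrizer T : 𝕜[Sym n])}) (h : x * colSum 𝕜 T = 0) :
    x = 0 := by
  obtain ⟨z, rfl⟩ := Ideal.mem_span_singleton'.1 hx
  obtain ⟨c, hc⟩ := rowSum_mul_rowSum (𝕜 := 𝕜) T
  by_contra h0
  have h1 : pairing (z * oppositeSymmetrizer T) (z * oppositeSymmetrizer T) = 0 := by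
    calc pairing (z * oppositeSymmetrizer T) (z * oppositeSymmetrizer T)
        = pairing (z * oppositeSymmetrizer T * rowSum 𝕜 T) (z * colSum 𝕜 T) := by
          rw [pairing_mul_rowSum, oppositeSymmetrizer, mul_assoc]
      _ = (starRingEnd 𝕜) c * pairing (z * oppositeSymmetrizer T) (z * colSum 𝕜 T) := by
          rw [← pairing_smul_left, oppositeSymmetrizer, mul_assoc z, mul_assoc, hc]
          simp
      _ = 0 := by rw [← pairing_mul_colSum, h]; simp [pairing]
  rw [pairing_self, RCLike.ofReal_eq_zero] at h1
  have hne : ⇑(z * oppositeSymmetrizer T : 𝕜[Sym n]).coeff ≠ 0 := fun e =>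
    h0 (MonoidAlgebra.coeff_injective (DFunLike.coe_injective e))
  exact (sqNorm_pos hne).ne' h1

lemma mul_colSum_mem {x : 𝕜[Sym n]}
    (hx : x ∈ Ideal.span {(oppositeSymmetrizer T : 𝕜[Sym n])}) :
    x * colSum 𝕜 T ∈ Ideal.span {youngSymmetrizer 𝕜 T} := by
  obtain ⟨z, rfl⟩ := Ideal.mem_span_singleton'.1 hx
  refine Ideal.mem_span_singleton'.2 ⟨z * colSum 𝕜 T, ?_⟩
  simp only [youngSymmetrizer, oppositeSymmetrizer, mul_assoc]

lemma nontrivial_span_youngSymmetrizer : Nontrivial (Ideal.span {youngSymmetrizer 𝕜 T}) := by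
  have hmem := Ideal.subset_span (Set.mem_singleton (oppositeSymmetrizer T : 𝕜[Sym n]))
  refine ⟨⟨_, mul_colSum_mem T hmem⟩, 0, fun h => ?_⟩
  exact oppositeSymmetrizer_ne_zero T (eq_zero_of_mul_colSum_eq_zero T hmem (congrArg Subtype.val h))

end Tableaux

/-! ### Comparison of the smallest eigenvalues -/

section Order

variable {𝕜 : Type*} [RCLike 𝕜] {n : ℕ} {V : Type*} [AddCommGroup V] [Module 𝕜 V]

lemma HasYoungDiagram.isLeast_lambda1 {ρ : Representation 𝕜 (Sym n) V} {μ : YoungDiagram}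
    (h : HasYoungDiagram ρ μ) (A : Matrix (Fin n) (Fin n) ℝ) :
    IsLeast (eigenvalueSet A ρ) (lambda1 A ρ) := by
  obtain ⟨T, ⟨φ⟩⟩ := h
  have : FiniteDimensional 𝕜 𝕜[Sym n] :=
    Module.Finite.equiv (toEuclidean (𝕜 := 𝕜) (n := n)).symm
  have hfin : FiniteDimensional 𝕜 (Ideal.span {youngSymmetrizer 𝕜 T}) :=
    inferInstanceAs (FiniteDimensional 𝕜 ((Ideal.span {youngSymmetrizer 𝕜 T}).restrictScalars 𝕜))
  have : FiniteDimensional 𝕜 V := Module.Finite.equiv φ.toLinearEquiv.symm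
  have := nontrivial_span_youngSymmetrizer (𝕜 := 𝕜) T
  have : Nontrivial V := φ.toLinearEquiv.toEquiv.nontrivial
  exact lambda1_isLeast A ρ

/-- The bottom of the spectrum of a Specht module is bounded by the Rayleigh quotients of the
elements of the left ideal generated by the opposite symmetrizer. -/
lemma lambda1_mul_sqNorm_le_energy {ρ : Representation 𝕜 (Sym n) V} {μ : YoungDiagram}
    {T : Fin n ≃ μ.cells} (φ : ρ.Equiv (specht 𝕜 T)) {A : Matrix (Fin n) (Fin n) ℝ}
    (hA : ∀ i j, i < j → 0 ≤ A i j) {w : 𝕜[Sym n]}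
    (hw : w ∈ Ideal.span {(oppositeSymmetrizer T : 𝕜[Sym n])}) (hw0 : w ≠ 0) :
    lambda1 A ρ * sqNorm w.coeff ≤ energy A w.coeff := by
  obtain ⟨l, x, hx, hx0, hl, hle⟩ := exists_eigenvector_le hA _ hw hw0
  refine le_trans (mul_le_mul_of_nonneg_right ?_ (Finset.sum_nonneg fun g _ => sq_nonneg _)) hle
  refine (HasYoungDiagram.isLeast_lambda1 ⟨T, ⟨φ⟩⟩ A).2 ?_
  rw [eigenvalueSet_congr φ]
  -- Right multiplication by `b` commutes with the Laplacian acting on the left, so it carries the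
  -- eigenvector into the Specht module with the same eigenvalue.
  refine mem_eigenvalueSet_ofModule'.2 ⟨x * colSum 𝕜 T, mul_colSum_mem T hx,
    fun h => hx0 (eq_zero_of_mul_colSum_eq_zero T hx h), ?_⟩
  rw [← mul_assoc, hl, smul_mul_assoc]

variable {W : Type*} [AddCommGroup W] [Module 𝕜 W]

lemma lambda1_le_lambda1 {k : ℕ} (hn : 2 ≤ n) (hnk : 4 * k ^ 2 + 4 * k ≤ n)
    {τ : Representation 𝕜 (Sym n) V} {σ : Representation 𝕜 (Sym n) W} {μ ν : YoungDiagram}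
    (hτ : HasYoungDiagram τ μ) (hσ : HasYoungDiagram σ ν)
    (hμ : (n : ℤ) - k ≤ μ.rowLen 0) (hν : (n : ℤ) - k ≤ ν.colLen 0)
    {A : Matrix (Fin n) (Fin n) ℝ} (hA : ∀ i j, i < j → 0 ≤ A i j) :
    lambda1 A τ ≤ lambda1 A σ ∧ ((∀ i j, i < j → 0 < A i j) → lambda1 A τ < lambda1 A σ) := by
  have hmem := (hσ.isLeast_lambda1 A).1
  obtain ⟨T, ⟨φ⟩⟩ := hτ
  obtain ⟨U, ⟨ψ⟩⟩ := hσ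
  rw [eigenvalueSet_congr ψ] at hmem
  obtain ⟨f, hf, hf0, hfl⟩ := mem_eigenvalueSet_ofModule'.1 hmem
  have hcoe : ∀ x : 𝕜[Sym n], x ≠ 0 → ⇑x.coeff ≠ 0 := fun x hx e =>
    hx (MonoidAlgebra.coeff_injective (DFunLike.coe_injective e))
  have hw := Ideal.subset_span (Set.mem_singleton (oppositeSymmetrizer T : 𝕜[Sym n]))
  have hw0 := oppositeSymmetrizer_ne_zero (𝕜 := 𝕜) T
  have hC : (firstCol U)ᶜ.card ≤ k := by
    rw [Finset.card_compl, card_firstCol, Fintype.card_fin]; omega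
  have hR : (firstRow T)ᶜ.card ≤ k := by
    rw [Finset.card_compl, card_firstRow, Fintype.card_fin]; omega
  obtain ⟨P, hP, hle, i, j, hij, hlt⟩ := exists_sum_swapEnergy_translate_le hn hnk (hcoe f hf0)
    (hcoe _ hw0) hC hR ((card_deepCols_le T).trans (by omega))
    (coeff_swap_mul_of_mem_span U hf) (coeff_swap_mul_of_mem_span_opposite T hw)
    (fun g i => mem_deepCols_of_coeff_ne_zero T)
  have hl : ∀ π, lambda1 A τ * sqNorm (oppositeSymmetrizer T : 𝕜[Sym n]).coeff ≤
      energy A (translate π (oppositeSymmetrizer T : 𝕜[Sym n]).coeff) := fun π => by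
    rw [← sqNorm_translate π, ← coeff_of_mul]
    refine lambda1_mul_sqNorm_le_energy φ hA (Ideal.mul_mem_left _ _ hw) fun h => hw0 ?_
    have h2 := congrArg (MonoidAlgebra.of 𝕜 (Sym n) π⁻¹ * ·) h
    simpa only [← mul_assoc, ← map_mul, inv_mul_cancel, map_one, one_mul, mul_zero] using h2
  have hN := sqNorm_pos (hcoe f hf0)
  obtain ⟨h1, h2⟩ := mul_sqNorm_le_energy hP (hcoe _ hw0) hA hle hl (hcoe f hf0)
  rw [energy_of_laplacian_mul_eq hfl] at h1 h2
  exact ⟨le_of_mul_le_mul_right h1 hN,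
    fun hpos => lt_of_mul_lt_mul_right (h2 ⟨i, j, hij, hpos i j hij, hlt⟩) hN.le⟩

end Order

end AldousOrder

end

theorem mainTheorem1 {𝕜 : Type*} [RCLike 𝕜] (n k : ℕ) (hn : 2 ≤ n)
    (hnk : 4 * k ^ 2 + 4 * k ≤ n)
    {V : Type*} [AddCommGroup V] [Module 𝕜 V] {W : Type*} [AddCommGroup W] [Module 𝕜 W]
    (τ : Representation 𝕜 (AldousOrder.Sym n) V) (σ : Representation 𝕜 (AldousOrder.Sym n) W)
    (μ ν : YoungDiagram)
    (hτ : AldousOrder.HasYoungDiagram τ μ) (hσ : AldousOrder.HasYoungDiagram σ ν)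
    (hμ : (n : ℤ) - k ≤ μ.rowLen 0) (hν : (n : ℤ) - k ≤ ν.colLen 0) :
    AldousOrder.AldousLT σ τ := by
  refine ⟨fun A hA => (AldousOrder.lambda1_le_lambda1 hn hnk hτ hσ hμ hν hA).1, ?_⟩
  rintro ⟨φ⟩
  -- With all weights equal to `1` the inequality is strict, whereas isomorphic representations have
  -- the same eigenvalues.
  have h := (AldousOrder.lambda1_le_lambda1 hn hnk hτ hσ hμ hν (A := Matrix.of fun _ _ => 1)
    fun _ _ _ => zero_le_one).2 fun _ _ _ => one_pos
  unfold AldousOrder.lambda1 at h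
  rw [AldousOrder.eigenvalueSet_congr φ] at h
  exact lt_irrefl _ h
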